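/- Let $M,N\ge 0$ be integers and $a_0,\dots,a_M\in\mathbb R$. Write $(x)_n=x(x+1)\cdots(x+n-1)$, $(x)_0=1$. Given real polynomials $p_0,p_1,p_2,\dots$ with $\deg p_n=n$, put $f_M=\sum_{m=0}^M a_m p_m$. The convolution matrix of $f_M$ with respect to $(p_n)$ is the $(M+N+2)\times(N+1)$ real matrix $R=(R_{k,n})$, $0\le k\le M+N+1$, $0\le n\le N$, determined by $$\int_{-1}^{y} f_M(y-1-t)\,p_n(t)\,dt=\sum_{k=0}^{M+N+1}R_{k,n}\,p_k(y),\qquad y\in[-1,1],\quad 0\le n\le N.$$ In each of the following three cases this matrix exists and is unique, and for all integers $k,n$ with $M+1\le k\le N$ and $M+1\le n\le N$ the stated symmetry holds. (1) (Jacobi) Let $\alpha,\beta>-1$ and $p_n=P_n^{(\alpha,\beta)}$, where $P_n^{(\alpha,\beta)}(x)=\frac{(\alpha+1)_n}{n!}\,{}_2F_1\big(-n,\,n+\alpha+\beta+1;\,\alpha+1;\,\tfrac{1-x}{2}\big)$. Then $$R_{n,k}=(-1)^{k+n}\,\frac{(\alpha+\beta+2n+1)\,(\alpha+1)_k\,(\beta+1)_k\,\big((\alpha+\beta+1)_n\big)^2}{(\alpha+\beta+2k+1)\,(\alpha+1)_n\,(\beta+1)_n\,\big((\alpha+\beta+1)_k\big)^2}\;R_{k,n},$$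 where, if $\alpha+\beta+1=0$, the quotient $(\alpha+\beta+1)_n/(\alpha+\beta+1)_k$ is read as its limiting value $(n-1)!/(k-1)!$. (2) (Chebyshev) Let $p_n=T_n$ be the Chebyshev polynomials of the first kind. Then $R_{n,k}=\frac{(-1)^{n+k}k}{n}R_{k,n}$. (3) (Gegenbauer) Let $\lambda>-\tfrac12$, $\lambda\ne0$, and let $p_n=C_n^{(\lambda)}$ be defined by $C_{-1}^{(\lambda)}=0$, $C_0^{(\lambda)}=1$ and $2(n+\lambda)x\,C_n^{(\lambda)}(x)=(n+1)C_{n+1}^{(\lambda)}(x)+(n+2\lambda-1)C_{n-1}^{(\lambda)}(x)$ for $n\ge0$. Then $R_{k,n}=(-1)^{k+n}\frac{k+\lambda}{n+\lambda}R_{n,k}$. -/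

import Mathlib

open scoped Nat

noncomputable section

/-- The ascending factorial `(x)_n = x (x + 1) ⋯ (x + n - 1)`, with `(x)_0 = 1`. -/
def rising (x : ℝ) (n : ℕ) : ℝ := (ascPochhammer ℝ n).eval x

/-- The Jacobi polynomial
`P_n^{(α,β)}(x) = (α+1)_n / n! · ₂F₁(-n, n+α+β+1; α+1; (1-x)/2)`, for `α, β > -1`. -/
def jacobiP (α β : ℝ) (n : ℕ) (x : ℝ) : ℝ :=
  rising (α + 1) n / (n ! : ℝ) *
    ordinaryHypergeometric (-(n : ℝ)) (n + α + β + 1) (α + 1) ((1 - x) / 2)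

/-- The Gegenbauer polynomial `C_n^{(μ)}`, by the three-term recurrence
`2 (n + μ) x C_n(x) = (n + 1) C_{n+1}(x) + (n + 2 μ - 1) C_{n-1}(x)` with
`C_{-1} = 0` and `C_0 = 1`. -/
def gegenbauerC (μ : ℝ) : ℕ → ℝ → ℝ
  | 0, _ => 1
  | 1, x => 2 * μ * x
  | n + 2, x =>
      (2 * ((n : ℝ) + 1 + μ) * x * gegenbauerC μ (n + 1) x
        - ((n : ℝ) + 2 * μ) * gegenbauerC μ n x) / ((n : ℝ) + 2)

/-- The Chebyshev polynomial of the first kind, as a function. -/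
def chebyshevT (n : ℕ) (x : ℝ) : ℝ := (Polynomial.Chebyshev.T ℝ (n : ℤ)).eval x

/-- The Volterra convolution `(f ∗ g)(x) = ∫_{-1}^{x+1} f(x - t) g(t) dt`, for `x ∈ [-2, 0]`. -/
def volterraConv (f g : ℝ → ℝ) (x : ℝ) : ℝ :=
  ∫ t in (-1 : ℝ)..(x + 1), f (x - t) * g t

/-- The series `f_M = ∑_{m=0}^M a_m p_m`. -/
def polySeries (p : ℕ → ℝ → ℝ) {M : ℕ} (a : Fin (M + 1) → ℝ) (x : ℝ) : ℝ :=
  ∑ m : Fin (M + 1), a m * p m x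

/-- `R` is the `(M+N+2) × (N+1)` convolution matrix, with respect to the polynomials `p_0, p_1, …`,
of the series `f_M = ∑_{m=0}^M a_m p_m`: its `n`-th column, `0 ≤ n ≤ N`, holds the coefficients of
`f_M ∗ p_n`, translated to `[-1, 1]` by `y = x + 1`, as a series in `p_0, …, p_{M+N+1}`. -/
def IsConvMatrix (p : ℕ → ℝ → ℝ) {M N : ℕ} (a : Fin (M + 1) → ℝ)
    (R : Matrix (Fin (M + N + 2)) (Fin (N + 1)) ℝ) : Prop :=
  ∀ n : Fin (N + 1), ∀ y ∈ Set.Icc (-1 : ℝ) 1,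
    volterraConv (polySeries p a) (p n) (y - 1) = ∑ k : Fin (M + N + 2), R k n * p k y

end

open scoped Nat

/-! Let `S q (y) = ∫_{-1}^y q`. Expanding `f_M` at `-1` and using Cauchy's formula for repeated
integration, convolution with `f_M` is `∑_{j ≤ M} f_M^{(j)}(-1) S^{j+1}` (`volterraConv_eval`), so
`R` is a polynomial in the matrix of `S`. Each family satisfies `P_n = A_n P'_{n+1} + B_n P'_n + G_n
P'_{n-1}`; integrating, the matrix of `S` is tridiagonal outside row 0, which collects the constants
of integration. If `G_{m+1} D_{m+1} = -A_m D_m`, then with `E = diag((-1)^k D_k)` the tridiagonal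
part satisfies `S E = E Sᵀ`, and this relation passes to powers. In `S^r` the constants of
integration reach degree at most `r - 1`, so the symmetry survives for indices `≥ r`
(`coord_primitiveNegOne_pow_symm`). The largest power is `M + 1`, whence the range in the theorem.
What remains for each family is its derivative recurrence and its weight `D`. -/

namespace Polynomial

/-! ### Convolution as a polynomial in the integration operator. -/

/-- The primitive of a real polynomial that vanishes at `-1`. -/
noncomputable def primitiveNegOne : ℝ[X] →ₗ[ℝ] ℝ[X] :=
  lsum fun n => (LinearMap.id : ℝ →ₗ[ℝ] ℝ).smulRight
    (((n : ℝ) + 1)⁻¹ • (X ^ (n + 1) - C ((-1) ^ (n + 1))))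

lemma primitiveNegOne_monomial (n : ℕ) (a : ℝ) :
    primitiveNegOne (monomial n a) =
      a • ((n : ℝ) + 1)⁻¹ • (X ^ (n + 1) - C ((-1) ^ (n + 1))) := by
  simp [primitiveNegOne, lsum]

@[simp]
lemma derivative_primitiveNegOne (q : ℝ[X]) : derivative (primitiveNegOne q) = q := by
  induction q using Polynomial.induction_on' with
  | add p q hp hq => simp [hp, hq]
  | monomial n a =>
    have h : (n : ℝ) + 1 ≠ 0 := by positivity
    rw [primitiveNegOne_monomial, derivative_smul, derivative_smul, derivative_sub, derivative_C,
      derivative_X_pow, sub_zero, ← C_mul_X_pow_eq_monomial]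
    simp only [smul_eq_C_mul, Nat.cast_add, Nat.cast_one, add_tsub_cancel_right]
    rw [← mul_assoc (C ((n : ℝ) + 1)⁻¹), ← C_mul, inv_mul_cancel₀ h, C_1, one_mul]

@[simp]
lemma eval_neg_one_primitiveNegOne (q : ℝ[X]) : (primitiveNegOne q).eval (-1) = 0 := by
  induction q using Polynomial.induction_on' with
  | add p q hp hq => simp [hp, hq]
  | monomial n a => simp [primitiveNegOne_monomial]

lemma primitiveNegOne_derivative (q : ℝ[X]) :
    primitiveNegOne (derivative q) = q - C (q.eval (-1)) := by
  have h : derivative (primitiveNegOne (derivative q) - q) = 0 := by simp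
  have h1 := eq_C_of_derivative_eq_zero h
  have h2 : (primitiveNegOne (derivative q) - q).eval (-1) = -q.eval (-1) := by simp
  rw [h1, eval_C] at h2
  rw [h2] at h1
  rw [sub_eq_iff_eq_add.1 h1]
  simp; ring

lemma natDegree_primitiveNegOne_le (q : ℝ[X]) :
    (primitiveNegOne q).natDegree ≤ q.natDegree + 1 := by
  have := natDegree_derivative (primitiveNegOne q)
  rw [derivative_primitiveNegOne] at this
  omega

lemma natDegree_primitiveNegOne_pow_le (r : ℕ) (q : ℝ[X]) :
    ((primitiveNegOne ^ r) q).natDegree ≤ q.natDegree + r := by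
  induction r with
  | zero => simp
  | succ r ih =>
    rw [pow_succ', Module.End.mul_apply]
    exact (natDegree_primitiveNegOne_le _).trans (by omega)

/-- Cauchy's formula for repeated integration, by induction with one integration by parts per step.
-/
lemma integral_sub_pow_mul_eval (j : ℕ) (q : ℝ[X]) (y : ℝ) :
    ∫ t in (-1 : ℝ)..y, (y - t) ^ j * q.eval t =
      (j ! : ℝ) * ((primitiveNegOne ^ (j + 1)) q).eval y := by
  induction j generalizing q with
  | zero =>
    have h := intervalIntegral.integral_eq_sub_of_hasDerivAt (a := -1) (b := y)
      (fun x _ => (primitiveNegOne q).hasDerivAt x)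
      ((Polynomial.continuous _).intervalIntegrable _ _)
    simpa using h
  | succ j ih =>
    have h := intervalIntegral.integral_deriv_mul_eq_sub (a := -1) (b := y)
      (u := fun t => (y - t) ^ (j + 1)) (v := fun t => (primitiveNegOne q).eval t)
      (u' := fun t => -((j + 1 : ℝ) * (y - t) ^ j)) (v' := fun t => q.eval t)
      (fun x _ => by
        have := ((hasDerivAt_id x).const_sub y).pow (j + 1)
        simpa [Pi.pow_def] using this)
      (fun x _ => by
        have := (primitiveNegOne q).hasDerivAt x
        rwa [derivative_primitiveNegOne] at this)
      (Continuous.intervalIntegrable (by fun_prop) _ _)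
      (Continuous.intervalIntegrable (by fun_prop) _ _)
    rw [intervalIntegral.integral_add (Continuous.intervalIntegrable (by fun_prop) _ _)
      (Continuous.intervalIntegrable (by fun_prop) _ _)] at h
    have h2 : ∫ t in (-1 : ℝ)..y, -((j + 1 : ℝ) * (y - t) ^ j) * (primitiveNegOne q).eval t =
        -(j + 1 : ℝ) * ∫ t in (-1 : ℝ)..y, (y - t) ^ j * (primitiveNegOne q).eval t := by
      rw [← intervalIntegral.integral_const_mul]
      congr 1; ext t; ring
    rw [h2, ih] at h
    simp only [sub_self, eval_neg_one_primitiveNegOne] at h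
    rw [pow_succ primitiveNegOne (j + 1), Module.End.mul_apply, Nat.factorial_succ]
    push_cast
    simp only [ne_eq, Nat.add_eq_zero_iff, one_ne_zero, and_false, not_false_eq_true, zero_pow,
      zero_mul, mul_zero, sub_self] at h
    linarith

/-- The polynomial `y ↦ ∫_{-1}^y F (y - 1 - t) q(t) dt`, for `F` of degree at most `M`. -/
noncomputable def volterra (M : ℕ) (F : ℝ[X]) : ℝ[X] →ₗ[ℝ] ℝ[X] :=
  ∑ j ∈ Finset.range (M + 1), ((taylor (-1) F).coeff j * (j ! : ℝ)) • primitiveNegOne ^ (j + 1)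

lemma volterraConv_eval {M : ℕ} {F : ℝ[X]} (hF : F.natDegree ≤ M) (q : ℝ[X]) (y : ℝ) :
    volterraConv (fun x => F.eval x) (fun x => q.eval x) (y - 1) = (volterra M F q).eval y := by
  have hexp : ∀ t, F.eval (y - 1 - t) =
      ∑ j ∈ Finset.range (M + 1), (taylor (-1) F).coeff j * (y - t) ^ j := by
    intro t
    have h : F.eval (y - 1 - t) = (taylor (-1) F).eval (y - t) := by
      rw [taylor_eval]; congr 1; ring
    rw [h, eval_eq_sum_range' (n := M + 1)]
    rw [natDegree_taylor]; omega
  simp only [volterraConv, hexp, sub_add_cancel, Finset.sum_mul]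
  rw [intervalIntegral.integral_finsetSum
    fun j _ => Continuous.intervalIntegrable (by fun_prop) _ _]
  simp only [volterra, LinearMap.sum_apply, LinearMap.smul_apply, eval_finsetSum, eval_smul,
    smul_eq_mul]
  refine Finset.sum_congr rfl fun j _ => ?_
  rw [mul_assoc, ← integral_sub_pow_mul_eval, ← intervalIntegral.integral_const_mul]
  congr 1; ext t; ring

lemma natDegree_volterra_le (M : ℕ) (F q : ℝ[X]) :
    (volterra M F q).natDegree ≤ M + q.natDegree + 1 := by
  simp only [volterra, LinearMap.sum_apply, LinearMap.smul_apply]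
  refine natDegree_sum_le_of_forall_le _ _ fun j hj => (natDegree_smul_le _ _).trans ?_
  have := natDegree_primitiveNegOne_pow_le (j + 1) q
  rw [Finset.mem_range] at hj
  omega

/-! ### Coordinates with respect to a graded basis. -/

namespace Sequence

variable (P : Sequence ℝ)

/-- The basis of `ℝ[X]` formed by a sequence of real polynomials of degrees `0, 1, 2, …`. -/
noncomputable def realBasis : Module.Basis ℕ ℝ ℝ[X] :=
  P.basis fun i => (leadingCoeff_ne_zero.2 (P.ne_zero i)).isUnit

@[simp]
lemma realBasis_apply (n : ℕ) : P.realBasis n = P n := by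
  simp [realBasis]

lemma realBasis_coord_self (k n : ℕ) :
    P.realBasis.coord k (P n) = if n = k then 1 else 0 := by
  rw [← realBasis_apply, Module.Basis.coord_apply, Module.Basis.repr_self, Finsupp.single_apply]

lemma mem_span_of_natDegree_lt {m : ℕ} {q : ℝ[X]} (hq : q.natDegree < m) :
    q ∈ Submodule.span ℝ (P '' Set.Iio m) := by
  rw [P.span_degreeLT fun i _ => (leadingCoeff_ne_zero.2 (P.ne_zero i)).isUnit, mem_degreeLT]
  exact degree_le_natDegree.trans_lt (by exact_mod_cast hq)

lemma coord_eq_zero_of_natDegree_lt {k : ℕ} {q : ℝ[X]} (hq : q.natDegree < k) :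
    P.realBasis.coord k q = 0 := by
  have h := P.mem_span_of_natDegree_lt hq
  clear hq
  induction h using Submodule.span_induction with
  | mem x hx =>
    obtain ⟨i, hi, rfl⟩ := hx
    rw [realBasis_coord_self, if_neg (ne_of_lt hi)]
  | zero => simp
  | add x y _ _ hx hy => simp_all
  | smul a x _ hx => simp_all

lemma sum_coord_smul {m : ℕ} {q : ℝ[X]} (hq : q.natDegree < m) :
    ∑ k : Fin m, P.realBasis.coord k q • P k = q := by
  have h := P.mem_span_of_natDegree_lt hq
  clear hq
  induction h using Submodule.span_induction with
  | mem x hx =>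
    obtain ⟨i, hi, rfl⟩ := hx
    simp only [realBasis_coord_self, ite_smul, one_smul, zero_smul]
    rw [Finset.sum_eq_single (⟨i, hi⟩ : Fin m)] <;> simp +contextual [Fin.ext_iff, eq_comm]
  | zero => simp
  | add x y _ _ hx hy =>
    simp only [map_add, add_smul, Finset.sum_add_distrib, hx, hy]
  | smul a x _ hx =>
    simp only [map_smul, smul_assoc, ← Finset.smul_sum, hx]

end Sequence
end Polynomial

namespace Polynomial.Sequence

/-! ### Symmetry of the powers of a tridiagonal integration operator. -/

section Recurrence

variable (P : Sequence ℝ)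

lemma coord_C {k : ℕ} (hk : k ≠ 0) (c : ℝ) : P.realBasis.coord k (C c) = 0 :=
  P.coord_eq_zero_of_natDegree_lt (by rw [natDegree_C]; omega)

variable {P} {A B G : ℕ → ℝ}
  (hP : ∀ n, P n = A n • derivative (P (n + 1)) + B n • derivative (P n) +
    G n • derivative (P (n - 1)))

include hP

lemma exists_primitiveNegOne_eq (n : ℕ) :
    ∃ c : ℝ, primitiveNegOne (P n) = A n • P (n + 1) + B n • P n + G n • P (n - 1) + C c := by
  refine ⟨-(A n * (P (n + 1)).eval (-1) + B n * (P n).eval (-1) + G n * (P (n - 1)).eval (-1)), ?_⟩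
  conv_lhs => rw [hP n]
  simp only [map_add, map_smul, primitiveNegOne_derivative]
  simp only [smul_eq_C_mul, C_add, C_neg, C_mul]
  ring

/-- Expands the integration applied first. Its constant, integrated `r` more times, has degree at
most `r < k` and is invisible in row `k`. -/
lemma coord_primitiveNegOne_pow_succ {r k : ℕ} (hk : r < k) (n : ℕ) :
    P.realBasis.coord k ((primitiveNegOne ^ (r + 1)) (P n)) =
      A n * P.realBasis.coord k ((primitiveNegOne ^ r) (P (n + 1))) +
      B n * P.realBasis.coord k ((primitiveNegOne ^ r) (P n)) +
      G n * P.realBasis.coord k ((primitiveNegOne ^ r) (P (n - 1))) := by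
  obtain ⟨c, hc⟩ := exists_primitiveNegOne_eq hP n
  have h0 : P.realBasis.coord k ((primitiveNegOne ^ r) (C c)) = 0 := by
    refine P.coord_eq_zero_of_natDegree_lt ?_
    have := natDegree_primitiveNegOne_pow_le r (C c)
    rw [natDegree_C] at this
    omega
  rw [pow_succ, Module.End.mul_apply, hc]
  simp only [map_add, map_smul, h0, smul_eq_mul, add_zero]

/-- The transposed expansion: it acts on the integration applied last, and its constant only affects
row 0. -/
lemma coord_succ_primitiveNegOne (k : ℕ) (q : ℝ[X]) :
    P.realBasis.coord (k + 1) (primitiveNegOne q) =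
      A k * P.realBasis.coord k q + B (k + 1) * P.realBasis.coord (k + 1) q +
      G (k + 2) * P.realBasis.coord (k + 2) q := by
  suffices h : P.realBasis.coord (k + 1) ∘ₗ primitiveNegOne =
      A k • P.realBasis.coord k + B (k + 1) • P.realBasis.coord (k + 1) +
      G (k + 2) • P.realBasis.coord (k + 2) by
    simpa using LinearMap.congr_fun h q
  refine P.realBasis.ext fun n => ?_
  obtain ⟨c, hc⟩ := exists_primitiveNegOne_eq hP n
  simp only [realBasis_apply, LinearMap.comp_apply, hc, map_add, map_smul, LinearMap.add_apply,
    LinearMap.smul_apply, realBasis_coord_self, P.coord_C k.succ_ne_zero, smul_eq_mul, add_zero,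
    add_left_inj]
  have h (F : ℕ → ℝ) (m : ℕ) : F n * (if n = m then 1 else 0) = F m * if n = m then 1 else 0 := by
    split_ifs with hnm
    · rw [hnm]
    · simp
  have h' : n - 1 = k + 1 ↔ n = k + 2 := by omega
  simp only [h']
  rw [h A, h B, h G]

/-- Induction on `r`: one side splits off the first integration, the other the last, and the
hypothesis on `D` matches the three terms pairwise. -/
lemma coord_primitiveNegOne_pow_symm {D : ℕ → ℝ}
    (hD : ∀ m, 1 ≤ m → G (m + 1) * D (m + 1) = -(A m * D m)) (r : ℕ) {k n : ℕ}
    (hk : 1 ≤ k) (hn : 1 ≤ n) (hrk : r ≤ k) (hrn : r ≤ n) :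
    D k * P.realBasis.coord n ((primitiveNegOne ^ r) (P k)) =
      (-1) ^ (k + n) * D n * P.realBasis.coord k ((primitiveNegOne ^ r) (P n)) := by
  induction r generalizing k n with
  | zero =>
    simp only [pow_zero, Module.End.one_apply, realBasis_coord_self]
    by_cases h : k = n
    · subst h; simp [← two_mul]
    · simp [h, Ne.symm h]
  | succ r ih =>
    obtain ⟨m, rfl⟩ : ∃ m, n = m + 1 := ⟨n - 1, by omega⟩
    rw [coord_primitiveNegOne_pow_succ hP (by omega : r < k), pow_succ', Module.End.mul_apply,
      coord_succ_primitiveNegOne hP, Nat.add_sub_cancel]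
    have h1 := ih (k := k) (n := m + 1) hk (by omega) (by omega) (by omega)
    have h2 := ih (k := k) (n := m + 2) hk (by omega) (by omega) (by omega)
    have d2 := hD (m + 1) (by omega)
    have h0 : D k * (A m * P.realBasis.coord m ((primitiveNegOne ^ r) (P k))) =
        (-1) ^ (k + (m + 1)) * D (m + 1) *
          (G (m + 1) * P.realBasis.coord k ((primitiveNegOne ^ r) (P m))) := by
      -- At `m = 0` the weight relation is not available, but then `r = 0` and both coordinates
      -- vanish because `k ≥ 1`.
      rcases Nat.eq_zero_or_pos m with rfl | hm
      · obtain rfl : r = 0 := by omega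
        simp only [pow_zero, Module.End.one_apply, realBasis_coord_self]
        rw [if_neg (by omega), if_neg (by omega), mul_zero, mul_zero, mul_zero, mul_zero]
      · have h := ih (k := k) (n := m) hk hm (by omega) (by omega)
        have d := hD m hm
        rw [← add_assoc, pow_succ]
        linear_combination A m * h + (-1) ^ (k + m) *
          P.realBasis.coord k ((primitiveNegOne ^ r) (P m)) * d
    rw [show k + (m + 2) = k + (m + 1) + 1 by ring, pow_succ] at h2
    rw [show m + 1 + 1 = m + 2 from rfl] at d2 ⊢
    linear_combination h0 + B (m + 1) * h1 + G (m + 2) * h2 - (-1) ^ (k + (m + 1)) *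
          P.realBasis.coord k ((primitiveNegOne ^ r) (P (m + 2))) * d2

lemma coord_volterra_symm {D : ℕ → ℝ}
    (hD : ∀ m, 1 ≤ m → G (m + 1) * D (m + 1) = -(A m * D m)) {M : ℕ} (F : ℝ[X]) {k n : ℕ}
    (hk : M + 1 ≤ k) (hn : M + 1 ≤ n) :
    D k * P.realBasis.coord n (volterra M F (P k)) =
      (-1) ^ (k + n) * D n * P.realBasis.coord k (volterra M F (P n)) := by
  simp only [volterra, LinearMap.sum_apply, LinearMap.smul_apply, map_sum, map_smul, smul_eq_mul,
    Finset.mul_sum]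
  refine Finset.sum_congr rfl fun j hj => ?_
  rw [Finset.mem_range] at hj
  have h := coord_primitiveNegOne_pow_symm hP hD (j + 1) (k := k) (n := n) (by omega) (by omega)
    (by omega) (by omega)
  linear_combination ((taylor (-1) F).coeff j * (j ! : ℝ)) * h

end Recurrence

/-! ### Existence, uniqueness and symmetry of the convolution matrix. -/

section ConvMatrix

variable (P : Sequence ℝ) {p : ℕ → ℝ → ℝ} (hp : ∀ n x, p n x = (P n).eval x)
  {M N : ℕ} (a : Fin (M + 1) → ℝ)

include hp

lemma isConvMatrix_iff (R : Matrix (Fin (M + N + 2)) (Fin (N + 1)) ℝ) :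
    IsConvMatrix p a R ↔
      ∀ k n, R k n = P.realBasis.coord k (volterra M (∑ m, a m • P m) (P n)) := by
  have hF : (∑ m : Fin (M + 1), a m • P m).natDegree ≤ M := by
    refine natDegree_sum_le_of_forall_le _ _ fun m _ => (natDegree_smul_le _ _).trans ?_
    rw [P.natDegree_eq]; omega
  have hs : polySeries p a = fun x => (∑ m : Fin (M + 1), a m • P m).eval x := by
    ext x
    simp [polySeries, hp, eval_finsetSum]
  have hc (n : ℕ) (y : ℝ) : volterraConv (polySeries p a) (p n) (y - 1) =
      (volterra M (∑ m, a m • P m) (P n)).eval y := by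
    rw [hs, show p n = fun x => (P n).eval x from _root_.funext (hp n), volterraConv_eval hF]
  have hd (n : Fin (N + 1)) :
      (volterra M (∑ m, a m • P m) (P n)).natDegree < M + N + 2 := by
    have := natDegree_volterra_le M (∑ m, a m • P m) (P n)
    rw [P.natDegree_eq] at this
    omega
  constructor
  · intro h k n
    have hq : volterra M (∑ m, a m • P m) (P n) = ∑ k : Fin (M + N + 2), R k n • P k := by
      -- Agreement on the infinite set `[-1, 1]` gives equality of polynomials, so the entries of
      -- `R` are forced.
      refine eq_of_infinite_eval_eq _ _ ((Set.Icc_infinite (by norm_num : (-1 : ℝ) < 1)).mono ?_)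
      intro y hy
      have := h n y hy
      rw [hc] at this
      simp [this, eval_finsetSum, hp]
    rw [hq, map_sum, Finset.sum_eq_single k]
    · simp [realBasis_coord_self, -Module.Basis.coord_apply]
    · intro b _ hb
      simp [realBasis_coord_self, -Module.Basis.coord_apply, Fin.val_inj, hb]
    · simp
  · intro h n y _
    rw [hc, ← P.sum_coord_smul (hd n), eval_finsetSum]
    simp [h, hp]

theorem existsUnique_isConvMatrix :
    ∃! R : Matrix (Fin (M + N + 2)) (Fin (N + 1)) ℝ, IsConvMatrix p a R := by
  simp only [P.isConvMatrix_iff hp]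
  refine ⟨fun k n => P.realBasis.coord k (volterra M (∑ m, a m • P m) (P n)), fun _ _ => rfl, ?_⟩
  intro R h
  ext k n
  exact h k n

theorem isConvMatrix_symm {A B G D : ℕ → ℝ}
    (hP : ∀ n, P n = A n • derivative (P (n + 1)) + B n • derivative (P n) +
      G n • derivative (P (n - 1)))
    (hD : ∀ m, 1 ≤ m → G (m + 1) * D (m + 1) = -(A m * D m))
    {R : Matrix (Fin (M + N + 2)) (Fin (N + 1)) ℝ} (hR : IsConvMatrix p a R) {k n : ℕ}
    (hk : M + 1 ≤ k) (hn : M + 1 ≤ n) (hkc : k < N + 1) (hnc : n < N + 1)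
    (hkr : k < M + N + 2) (hnr : n < M + N + 2) :
    D k * R ⟨n, hnr⟩ ⟨k, hkc⟩ =
      (-1) ^ (k + n) * D n * R ⟨k, hkr⟩ ⟨n, hnc⟩ := by
  rw [P.isConvMatrix_iff hp] at hR
  rw [hR, hR]
  exact coord_volterra_symm hP hD _ hk hn

end ConvMatrix

end Polynomial.Sequence

namespace Polynomial

/-! ### Derivative recurrence for Chebyshev polynomials. -/

section Chebyshev

/-- The Chebyshev polynomials of the first kind, as a sequence. -/
noncomputable def chebyshevSeq : Sequence ℝ where
  elems' n := Chebyshev.T ℝ n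
  degree_eq' n := by simp [Chebyshev.degree_T]

/-- From `2 T_n = U_n - U_{n-2}` and `T'_n = n U_{n-1}`. For `n ≤ 1` the last coefficient is
immaterial, since it multiplies `T_0' = 0`; this covers the zero denominator at `n = 1`. -/
lemma chebyshevSeq_recurrence (n : ℕ) :
    chebyshevSeq n = (if n = 0 then (1 : ℝ) else (2 * ((n : ℝ) + 1))⁻¹) •
        derivative (chebyshevSeq (n + 1)) + (0 : ℝ) • derivative (chebyshevSeq n) +
      (-(2 * ((n : ℝ) - 1))⁻¹) • derivative (chebyshevSeq (n - 1)) := by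
  match n with
  | 0 => simp [chebyshevSeq]
  | 1 =>
    have h : (C (4⁻¹ : ℝ) : ℝ[X]) * 4 = 1 := by
      rw [← map_ofNat C 4, ← C_mul, inv_mul_cancel₀ (by norm_num), C_1]
    have h2 : (2 * (((1 : ℕ) : ℝ) + 1))⁻¹ = 4⁻¹ := by norm_num
    rw [h2]
    simp [chebyshevSeq, Chebyshev.T_two, smul_eq_C_mul]
    linear_combination -X * h
  | m + 2 =>
    have h := Chebyshev.two_mul_T_eq_U_sub_U ℝ m
    have h1 : derivative (chebyshevSeq (m + 2 + 1)) = C ((m : ℝ) + 3) * Chebyshev.U ℝ (m + 2) := by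
      simp only [chebyshevSeq, Chebyshev.T_derivative_eq_U]
      push_cast
      rw [show (m : ℤ) + 2 + 1 - 1 = m + 2 by ring, C_add, map_ofNat C 3, C_eq_natCast]
      ring
    have h2 : derivative (chebyshevSeq (m + 2 - 1)) = C ((m : ℝ) + 1) * Chebyshev.U ℝ m := by
      simp only [chebyshevSeq, Chebyshev.T_derivative_eq_U, show m + 2 - 1 = m + 1 by omega]
      push_cast
      simp
    have h3 : chebyshevSeq (m + 2) = C (2⁻¹ : ℝ) * (2 * Chebyshev.T ℝ (m + 2)) := by
      rw [← mul_assoc, ← map_ofNat C 2, ← C_mul]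
      simp [chebyshevSeq]
    rw [h1, h2, h3, h, if_neg (by omega)]
    simp only [smul_eq_C_mul]
    rw [← mul_assoc, ← mul_assoc, ← C_mul, ← C_mul]
    have e1 : (2 * (((m + 2 : ℕ) : ℝ) + 1))⁻¹ * ((m : ℝ) + 3) = 2⁻¹ := by
      push_cast; field_simp; ring
    have e2 : -(2 * (((m + 2 : ℕ) : ℝ) - 1))⁻¹ * ((m : ℝ) + 1) = -2⁻¹ := by
      push_cast
      rw [show (m : ℝ) + 2 - 1 = m + 1 by ring]
      field_simp
    rw [e1, e2, C_neg, C_0]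
    ring

end Chebyshev

/-! ### Derivative recurrence for Gegenbauer polynomials. -/

section Gegenbauer

/-- The Gegenbauer polynomials, as formal polynomials. -/
noncomputable def gegenbauerPoly (μ : ℝ) : ℕ → ℝ[X]
  | 0 => 1
  | 1 => C (2 * μ) * X
  | n + 2 => C (2 * ((n : ℝ) + 1 + μ) / ((n : ℝ) + 2)) * (X * gegenbauerPoly μ (n + 1)) -
      C (((n : ℝ) + 2 * μ) / ((n : ℝ) + 2)) * gegenbauerPoly μ n

lemma gegenbauerC_eq_eval (μ : ℝ) (n : ℕ) (x : ℝ) :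
    gegenbauerC μ n x = (gegenbauerPoly μ n).eval x := by
  induction n using Nat.twoStepInduction with
  | zero => simp [gegenbauerC, gegenbauerPoly]
  | one => simp [gegenbauerC, gegenbauerPoly]
  | more n h1 h2 =>
    simp only [gegenbauerC, gegenbauerPoly, h1, h2, eval_sub, eval_mul, eval_C, eval_X]
    ring

lemma gegenbauerPoly_three_term (μ : ℝ) (n : ℕ) :
    ((n : ℝ[X]) + 2) * gegenbauerPoly μ (n + 2) =
      2 * ((n : ℝ[X]) + 1 + C μ) * X * gegenbauerPoly μ (n + 1) -
        ((n : ℝ[X]) + 2 * C μ) * gegenbauerPoly μ n := by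
  have h : (n : ℝ) + 2 ≠ 0 := by positivity
  have h0 : ((n : ℝ[X]) + 2) = C ((n : ℝ) + 2) := by simp [map_ofNat C]
  have h1 : 2 * ((n : ℝ[X]) + 1 + C μ) = C (2 * ((n : ℝ) + 1 + μ)) := by simp [map_ofNat C]
  have h2 : ((n : ℝ[X]) + 2 * C μ) = C ((n : ℝ) + 2 * μ) := by simp [map_ofNat C]
  have e (c : ℝ) : C ((n : ℝ) + 2) * C (c / ((n : ℝ) + 2)) = C c := by
    rw [← C_mul, mul_div_cancel₀ _ h]
  rw [h0, h1, h2, gegenbauerPoly]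
  linear_combination X * gegenbauerPoly μ (n + 1) * e (2 * ((n : ℝ) + 1 + μ)) -
    gegenbauerPoly μ n * e ((n : ℝ) + 2 * μ)

/-- Only the third identity is needed later, but the induction requires all three: the first
together with the differentiated three-term relation yields the third, and the three then advance
the first two. -/
lemma derivative_gegenbauerPoly_aux (μ : ℝ) (n : ℕ) :
    X * derivative (gegenbauerPoly μ (n + 1)) = derivative (gegenbauerPoly μ n) +
        ((n : ℝ[X]) + 1) * gegenbauerPoly μ (n + 1) ∧
      X * derivative (gegenbauerPoly μ n) = derivative (gegenbauerPoly μ (n + 1)) -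
        ((n : ℝ[X]) + 2 * C μ) * gegenbauerPoly μ n ∧
      derivative (gegenbauerPoly μ (n + 2)) = derivative (gegenbauerPoly μ n) +
        2 * ((n : ℝ[X]) + 1 + C μ) * gegenbauerPoly μ (n + 1) := by
  have key (n : ℕ) (h : X * derivative (gegenbauerPoly μ (n + 1)) =
      derivative (gegenbauerPoly μ n) + ((n : ℝ[X]) + 1) * gegenbauerPoly μ (n + 1)) :
      derivative (gegenbauerPoly μ (n + 2)) = derivative (gegenbauerPoly μ n) +
        2 * ((n : ℝ[X]) + 1 + C μ) * gegenbauerPoly μ (n + 1) := by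
    have h0 : (n : ℝ[X]) + 2 ≠ 0 := by exact_mod_cast (n + 1).cast_add_one_ne_zero (R := ℝ[X])
    refine mul_left_cancel₀ h0 ?_
    have ht := congrArg derivative (gegenbauerPoly_three_term μ n)
    simp only [derivative_mul, derivative_sub, derivative_add, derivative_natCast, derivative_ofNat,
      derivative_one, derivative_C, derivative_X] at ht
    linear_combination ht + 2 * ((n : ℝ[X]) + 1 + C μ) * h
  induction n with
  | zero =>
    have h : X * derivative (gegenbauerPoly μ (0 + 1)) = derivative (gegenbauerPoly μ 0) +
        (((0 : ℕ) : ℝ[X]) + 1) * gegenbauerPoly μ (0 + 1) := by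
      simp [gegenbauerPoly]; ring
    exact ⟨h, by simp [gegenbauerPoly, map_ofNat C], key 0 h⟩
  | succ n ih =>
    obtain ⟨h1, h2, h3⟩ := ih
    have h : X * derivative (gegenbauerPoly μ (n + 1 + 1)) = derivative (gegenbauerPoly μ (n + 1)) +
        (((n + 1 : ℕ) : ℝ[X]) + 1) * gegenbauerPoly μ (n + 1 + 1) := by
      push_cast
      linear_combination X * h3 + h2 - gegenbauerPoly_three_term μ n
    refine ⟨h, ?_, key (n + 1) h⟩
    push_cast
    linear_combination h1 - h3

lemma degree_gegenbauerPoly {μ : ℝ} (hμ : -1 / 2 < μ) (h0 : μ ≠ 0) (n : ℕ) :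
    (gegenbauerPoly μ n).degree = n := by
  induction n using Nat.twoStepInduction with
  | zero => simp [gegenbauerPoly]
  | one => simp [gegenbauerPoly, h0]
  | more n h1 h2 =>
    have hn : (0 : ℝ) ≤ n := n.cast_nonneg
    have hc : 2 * ((n : ℝ) + 1 + μ) / ((n : ℝ) + 2) ≠ 0 :=
      div_ne_zero (by linarith) (by linarith)
    have hd : (C (2 * ((n : ℝ) + 1 + μ) / ((n : ℝ) + 2)) * (X * gegenbauerPoly μ (n + 1))).degree =
        ((n + 2 : ℕ) : WithBot ℕ) := by
      rw [degree_C_mul hc, degree_mul, degree_X, h2]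
      norm_cast
      ring
    rw [gegenbauerPoly, degree_sub_eq_left_of_degree_lt, hd]
    rw [hd]
    refine (degree_le_of_natDegree_le (natDegree_C_mul_le _ _)).trans_lt ?_
    rw [natDegree_eq_of_degree_eq_some h1]
    exact_mod_cast (by omega : n < n + 2)

/-- The Gegenbauer polynomials, as a sequence. -/
noncomputable def gegenbauerSeq {μ : ℝ} (hμ : -1 / 2 < μ) (h0 : μ ≠ 0) : Sequence ℝ where
  elems' := gegenbauerPoly μ
  degree_eq' := degree_gegenbauerPoly hμ h0

lemma gegenbauerPoly_recurrence {μ : ℝ} (hμ : -1 / 2 < μ) (h0 : μ ≠ 0) (n : ℕ) :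
    gegenbauerPoly μ n = (2 * ((n : ℝ) + μ))⁻¹ • derivative (gegenbauerPoly μ (n + 1)) +
        (0 : ℝ) • derivative (gegenbauerPoly μ n) +
      (-(2 * ((n : ℝ) + μ))⁻¹) • derivative (gegenbauerPoly μ (n - 1)) := by
  rcases n with _ | n
  · simp only [gegenbauerPoly, smul_eq_C_mul]
    simp only [derivative_C_mul, derivative_X, derivative_one, mul_one, mul_zero, add_zero,
      zero_add, ← C_mul, Nat.cast_zero, zero_tsub, gegenbauerPoly]
    rw [inv_mul_cancel₀ (by simpa using h0), C_1]
  · have hn : (0 : ℝ) ≤ n := n.cast_nonneg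
    have hc : 2 * (((n + 1 : ℕ) : ℝ) + μ) ≠ 0 := by push_cast; linarith
    have h := (derivative_gegenbauerPoly_aux μ n).2.2
    rw [show 2 * ((n : ℝ[X]) + 1 + C μ) = C (2 * (((n + 1 : ℕ) : ℝ) + μ)) by
      simp [map_ofNat C]] at h
    rw [Nat.add_sub_cancel, h, smul_add, ← smul_eq_C_mul, smul_smul, inv_mul_cancel₀ hc]
    module

end Gegenbauer
end Polynomial

/-! ### Rising factorials and the derivative recurrence for Jacobi polynomials. -/

lemma rising_succ (x : ℝ) (n : ℕ) : rising x (n + 1) = rising x n * (x + n) :=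
  ascPochhammer_succ_eval n x

lemma rising_succ_left (x : ℝ) (n : ℕ) : rising x (n + 1) = x * rising (x + 1) n := by
  simp [rising, ascPochhammer_succ_left]

lemma rising_pos {x : ℝ} (hx : 0 < x) (n : ℕ) : 0 < rising x n :=
  ascPochhammer_pos n x hx

lemma rising_neg_eq_zero {n j : ℕ} (h : n < j) : rising (-(n : ℝ)) j = 0 :=
  ascPochhammer_eval_neg_coe_nat_of_lt h

lemma rising_neg_self_ne_zero (n : ℕ) : rising (-(n : ℝ)) n ≠ 0 := by
  rw [rising, Ne, ascPochhammer_eval_eq_zero_iff]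
  rintro ⟨k, hk, h⟩
  rw [neg_neg] at h
  exact hk.ne (by exact_mod_cast h)

namespace Polynomial

section Jacobi

/-- The coefficient of `((1 - x) / 2) ^ j` in the Jacobi polynomial `P_n^{(α,β)}(x)`. -/
noncomputable def jacobiCoeff (α β : ℝ) (n j : ℕ) : ℝ :=
  rising (α + 1) n / (n ! : ℝ) * ((j ! : ℝ)⁻¹ * rising (-(n : ℝ)) j * rising (n + α + β + 1) j *
    (rising (α + 1) j)⁻¹)

/-- The Jacobi polynomial as a formal polynomial in `(1 - x) / 2`. -/
noncomputable def jacobiHalf (α β : ℝ) (n : ℕ) : ℝ[X] :=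
  ∑ j ∈ Finset.range (n + 1), monomial j (jacobiCoeff α β n j)

/-- The Jacobi polynomial as a formal polynomial. -/
noncomputable def jacobiPoly (α β : ℝ) (n : ℕ) : ℝ[X] :=
  (jacobiHalf α β n).comp (C (1 / 2) * (1 - X))

lemma jacobiCoeff_eq_zero (α β : ℝ) {n j : ℕ} (h : n < j) : jacobiCoeff α β n j = 0 := by
  simp [jacobiCoeff, rising_neg_eq_zero h]

lemma coeff_jacobiHalf (α β : ℝ) (n j : ℕ) :
    (jacobiHalf α β n).coeff j = jacobiCoeff α β n j := by
  simp only [jacobiHalf, finsetSum_coeff, coeff_monomial, Finset.sum_ite_eq', Finset.mem_range]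
  split_ifs with h
  · rfl
  · rw [jacobiCoeff_eq_zero α β (by omega)]

lemma jacobiP_eq_eval (α β : ℝ) (n : ℕ) (x : ℝ) :
    jacobiP α β n x = (jacobiPoly α β n).eval x := by
  rw [jacobiP, ordinaryHypergeometric_eq_tsum]
  beta_reduce
  rw [tsum_eq_sum (s := Finset.range (n + 1))]
  · simp only [jacobiPoly, jacobiHalf, eval_comp, eval_finsetSum, eval_monomial, Finset.mul_sum,
      eval_mul, eval_C, eval_sub, eval_one, eval_X, smul_eq_mul, jacobiCoeff, rising]
    refine Finset.sum_congr rfl fun j _ => ?_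
    rw [show (1 - x) / 2 = 1 / 2 * (1 - x) by ring]
    ring
  · intro j hj
    have h := rising_neg_eq_zero (n := n) (j := j) (by simpa using hj)
    rw [rising] at h
    simp [h]

variable {α β : ℝ} (hα : -1 < α) (hβ : -1 < β)

include hα hβ

lemma jacobiCoeff_self_ne_zero (n : ℕ) : jacobiCoeff α β n n ≠ 0 := by
  have h1 := (rising_pos (by linarith : 0 < α + 1) n).ne'
  have h2 : rising (n + α + β + 1) n ≠ 0 := by
    rcases n with _ | n
    · simp [rising]
    · refine (rising_pos ?_ _).ne'
      have : (0 : ℝ) ≤ n := n.cast_nonneg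
      push_cast
      linarith
  have h3 := rising_neg_self_ne_zero n
  have h4 : (n ! : ℝ) ≠ 0 := by positivity
  unfold jacobiCoeff
  positivity

lemma degree_jacobiPoly (n : ℕ) : (jacobiPoly α β n).degree = n := by
  have hc := jacobiCoeff_self_ne_zero hα hβ n
  have h1 : (jacobiHalf α β n).natDegree = n := by
    refine natDegree_eq_of_le_of_coeff_ne_zero ?_ (by rwa [coeff_jacobiHalf])
    refine natDegree_le_iff_coeff_eq_zero.2 fun j hj => ?_
    rw [coeff_jacobiHalf, jacobiCoeff_eq_zero α β hj]
  have h2 : (C (1 / 2 : ℝ) * (1 - X)).natDegree = 1 := by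
    rw [natDegree_C_mul (by norm_num), ← natDegree_neg, neg_sub]
    exact natDegree_X_sub_C 1
  have h3 : (jacobiPoly α β n).natDegree = n := by
    rw [jacobiPoly, natDegree_comp, h1, h2, mul_one]
  rcases Nat.eq_zero_or_pos n with rfl | hn
  · have : jacobiPoly α β 0 = C (jacobiCoeff α β 0 0) := by simp [jacobiPoly, jacobiHalf]
    rw [this, degree_C hc, Nat.cast_zero]
  · exact (degree_eq_iff_natDegree_eq_of_pos hn).2 h3

/-- The Jacobi polynomials, as a sequence. -/
noncomputable def jacobiSeq : Sequence ℝ where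
  elems' := jacobiPoly α β
  degree_eq' := degree_jacobiPoly hα hβ

omit hα hβ

/-- The coefficient of `P'_{n+1}` in the expansion of `P_n^{(α,β)}`. -/
noncomputable def jacobiUp (α β : ℝ) (n : ℕ) : ℝ :=
  if n = 0 then 2 / (α + β + 2)
  else 2 * (n + α + β + 1) / ((2 * n + α + β + 1) * (2 * n + α + β + 2))

/-- The coefficient of `P'_n` in the expansion of `P_n^{(α,β)}`. -/
noncomputable def jacobiMid (α β : ℝ) (n : ℕ) : ℝ :=
  2 * (α - β) / ((2 * n + α + β) * (2 * n + α + β + 2))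

/-- The coefficient of `P'_{n-1}` in the expansion of `P_n^{(α,β)}`. -/
noncomputable def jacobiDown (α β : ℝ) (n : ℕ) : ℝ :=
  -(2 * (n + α) * (n + β)) / ((n + α + β) * (2 * n + α + β) * (2 * n + α + β + 1))

include hα hβ

/-- The derivative recurrence compared coefficientwise in `u = (1 - x) / 2`, where `d/dx = -(1/2)
d/du`. All rising factorials reduce to `a`, `b`, `x`, `y`, leaving a rational identity. -/
lemma jacobiCoeff_succ (m j : ℕ) :
    jacobiCoeff α β (m + 1) j = -(1 / 2) * (j + 1) *
      (jacobiUp α β (m + 1) * jacobiCoeff α β (m + 2) (j + 1) +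
        jacobiMid α β (m + 1) * jacobiCoeff α β (m + 1) (j + 1) +
        jacobiDown α β (m + 1) * jacobiCoeff α β m (j + 1)) := by
  have hm : (0 : ℝ) ≤ m := m.cast_nonneg
  have hj : (0 : ℝ) ≤ j := j.cast_nonneg
  have hs : 0 < (m : ℝ) + α + β + 2 := by linarith
  have n1 : 2 * (m : ℝ) + α + β + 2 ≠ 0 := by linarith
  have n2 : 2 * (m : ℝ) + α + β + 3 ≠ 0 := by linarith
  have n3 : 2 * (m : ℝ) + α + β + 4 ≠ 0 := by linarith
  have n4 : (m : ℝ) + α + 1 ≠ 0 := by linarith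
  have n5 : (j : ℝ) + α + 1 ≠ 0 := by linarith
  have n6 : (m : ℝ) + 1 ≠ 0 := by linarith
  have n7 : (j : ℝ) + 1 ≠ 0 := by linarith
  have n8 : (m : ℝ) + 2 ≠ 0 := by linarith
  have fm : (m ! : ℝ) ≠ 0 := by positivity
  have fj : (j ! : ℝ) ≠ 0 := by positivity
  have hb : rising (α + 1) j ≠ 0 := (rising_pos (by linarith) j).ne'
  set a := rising (α + 1) m with ha
  set b := rising (α + 1) j with hb'
  set x := rising (-((m : ℝ) + 1)) j with hx
  set y := rising ((m : ℝ) + α + β + 2) j with hy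
  have a1 : rising (α + 1) (m + 1) = a * (m + α + 1) := by rw [rising_succ]; ring
  have a2 : rising (α + 1) (m + 2) = a * (m + α + 1) * (m + α + 2) := by
    rw [rising_succ, a1]; push_cast; ring
  have b1 : rising (α + 1) (j + 1) = b * (j + α + 1) := by rw [rising_succ]; ring
  have x1 : rising (-((m : ℝ) + 1)) (j + 1) = x * (j - m - 1) := by rw [rising_succ]; ring
  have x2 : rising (-((m : ℝ) + 2)) (j + 1) = -(m + 2) * x := by
    rw [rising_succ_left, hx]; ring_nf
  have x0 : rising (-(m : ℝ)) (j + 1) = -(x * (j - m - 1) * (j - m)) / (m + 1) := by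
    have h := rising_succ_left (-((m : ℝ) + 1)) (j + 1)
    rw [rising_succ, x1, show -((m : ℝ) + 1) + 1 = -m by ring] at h
    push_cast at h
    rw [eq_div_iff n6]
    linear_combination h
  have y1 : rising ((m : ℝ) + α + β + 2) (j + 1) = y * (m + α + β + 2 + j) := rising_succ _ _
  have y2 : rising ((m : ℝ) + α + β + 3) (j + 1) =
      y * (m + α + β + 2 + j) * (m + α + β + 3 + j) / (m + α + β + 2) := by
    have h := rising_succ_left ((m : ℝ) + α + β + 2) (j + 1)
    rw [rising_succ, y1, show (m : ℝ) + α + β + 2 + 1 = m + α + β + 3 by ring] at h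
    push_cast at h
    rw [eq_div_iff hs.ne']
    linear_combination -h
  have y0 : rising ((m : ℝ) + α + β + 1) (j + 1) = (m + α + β + 1) * y := by
    rw [rising_succ_left, hy]; ring_nf
  have hdown : jacobiDown α β (m + 1) * jacobiCoeff α β m (j + 1) =
      -(2 * (m + 1 + α) * (m + 1 + β)) / ((2 * m + α + β + 2) * (2 * m + α + β + 3)) *
        (a / (m ! : ℝ) * (((j + 1)! : ℝ)⁻¹ * (-(x * (j - m - 1) * (j - m)) / (m + 1)) * y *
          (b * (j + α + 1))⁻¹)) := by
    rw [jacobiCoeff, x0, y0, b1, ← ha, jacobiDown]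
    push_cast
    rw [show 2 * ((m : ℝ) + 1) + α + β = 2 * m + α + β + 2 by ring,
      show 2 * (m : ℝ) + α + β + 2 + 1 = 2 * m + α + β + 3 by ring,
      show (m : ℝ) + 1 + α + β = m + α + β + 1 by ring]
    -- `jacobiDown` has a zero denominator here. As `α + β > -2`, this forces `m = 0`, where
    -- `(-m)_{j+1} = 0` makes both sides vanish.
    by_cases h0 : (m : ℝ) + α + β + 1 = 0
    · have hm0 : m = 0 := by
        by_contra h
        have : (1 : ℝ) ≤ m := by exact_mod_cast Nat.one_le_iff_ne_zero.2 h
        linarith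
      have hz : -(x * ((j : ℝ) - m - 1) * (j - m)) / (m + 1) = 0 := by
        rw [← x0]
        exact rising_neg_eq_zero (by omega)
      rw [hz]
      simp
    · have cancel (N d p q A f z y c : ℝ) (hd : d ≠ 0) :
          N / (d * p * q) * (A * (f * z * (d * y) * c)) = N / (p * q) * (A * (f * z * y * c)) := by
        rw [mul_assoc d, div_mul_eq_div_div_swap]
        field_simp
      exact cancel _ _ _ _ _ _ _ _ _ h0
  rw [hdown]
  simp only [jacobiCoeff, jacobiUp, jacobiMid, if_neg m.succ_ne_zero]
  push_cast
  rw [a1, a2, b1, ← hb', x2, x1, ← hx,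
    show (m : ℝ) + 1 + α + β + 1 = m + α + β + 2 by ring, y1, ← hy,
    show (m : ℝ) + 2 + α + β + 1 = m + α + β + 3 by ring, y2,
    show 2 * ((m : ℝ) + 1) + α + β = 2 * m + α + β + 2 by ring,
    show 2 * (m : ℝ) + α + β + 2 + 1 = 2 * m + α + β + 3 by ring,
    show 2 * (m : ℝ) + α + β + 2 + 2 = 2 * m + α + β + 4 by ring]
  simp only [Nat.factorial_succ]
  push_cast
  rw [show (m : ℝ) + 1 + 1 = m + 2 by ring]
  have hs' := hs.ne'
  clear_value a b x y
  clear hdown x0 x1 x2 y0 y1 y2 a1 a2 b1 ha hb' hx hy hα hβ hs hm hj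
  generalize (m ! : ℝ) = e at *
  generalize (j ! : ℝ) = f at *
  generalize (m : ℝ) = m at *
  generalize (j : ℝ) = j at *
  -- With `p = 2m + α + β + 2` as variable, the denominators become `p`, `p + 1`, `p + 2` and `p -
  -- m`.
  obtain ⟨p, rfl⟩ : ∃ p, β = p - 2 * m - α - 2 := ⟨2 * m + α + β + 2, by ring⟩
  rw [show 2 * m + α + (p - 2 * m - α - 2) + 2 = p by ring] at *
  rw [show 2 * m + α + (p - 2 * m - α - 2) + 3 = p + 1 by ring] at *
  rw [show 2 * m + α + (p - 2 * m - α - 2) + 4 = p + 2 by ring] at *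
  rw [show m + α + (p - 2 * m - α - 2) + 2 = p - m by ring] at *
  field_simp
  ring

/-- At `n = 0` the middle and lower terms vanish with the derivative of a constant, whatever their
coefficients; `jacobiUp` there has the possibly zero factor `α + β + 1` already cancelled. -/
lemma jacobiHalf_recurrence (n : ℕ) :
    jacobiHalf α β n = (-(1 / 2) : ℝ) • (jacobiUp α β n • derivative (jacobiHalf α β (n + 1)) +
      jacobiMid α β n • derivative (jacobiHalf α β n) +
      jacobiDown α β n • derivative (jacobiHalf α β (n - 1))) := by
  ext j
  simp only [coeff_smul, coeff_add, coeff_derivative, coeff_jacobiHalf, smul_eq_mul]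
  rcases n with _ | m
  · rw [jacobiCoeff_eq_zero α β (by omega : 0 < j + 1)]
    rcases j with _ | j
    · have h1 : α + 1 ≠ 0 := by linarith
      have h2 : α + β + 2 ≠ 0 := by linarith
      simp [jacobiCoeff, jacobiUp, rising]
      field_simp
      ring
    · rw [jacobiCoeff_eq_zero α β (by omega : 0 < j + 1),
        jacobiCoeff_eq_zero α β (by omega : 0 + 1 < j + 1 + 1)]
      ring
  · rw [jacobiCoeff_succ hα hβ, Nat.add_sub_cancel]
    ring

lemma jacobiPoly_recurrence (n : ℕ) :
    jacobiPoly α β n = jacobiUp α β n • derivative (jacobiPoly α β (n + 1)) +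
      jacobiMid α β n • derivative (jacobiPoly α β n) +
      jacobiDown α β n • derivative (jacobiPoly α β (n - 1)) := by
  have hd : derivative (C (1 / 2 : ℝ) * (1 - X)) = C (-(1 / 2)) := by
    rw [derivative_C_mul, derivative_sub, derivative_one, derivative_X, C_neg]; ring
  conv_lhs => rw [jacobiPoly, jacobiHalf_recurrence hα hβ n]
  simp only [jacobiPoly, derivative_comp, hd, smul_comp, add_comp]
  simp only [smul_eq_C_mul]
  ring

end Jacobi

end Polynomial

/-! ### Symmetrizing weights and the three cases. -/

open Polynomial

lemma chebyshev_symm_weights (m : ℕ) (hm : 1 ≤ m) :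
    -(2 * (((m + 1 : ℕ) : ℝ) - 1))⁻¹ * (((m + 1 : ℕ) : ℝ))⁻¹ =
      -((if m = 0 then (1 : ℝ) else (2 * ((m : ℝ) + 1))⁻¹) * ((m : ℝ))⁻¹) := by
  have h : (m : ℝ) ≠ 0 := by positivity
  rw [if_neg (by omega)]
  push_cast
  rw [add_sub_cancel_right]
  field_simp

lemma gegenbauer_symm_weights {μ : ℝ} (hμ : -1 / 2 < μ) (m : ℕ) (hm : 1 ≤ m) :
    -(2 * (((m + 1 : ℕ) : ℝ) + μ))⁻¹ * (((m + 1 : ℕ) : ℝ) + μ) =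
      -((2 * ((m : ℝ) + μ))⁻¹ * ((m : ℝ) + μ)) := by
  have h : (1 : ℝ) ≤ m := by exact_mod_cast hm
  have h1 : (m : ℝ) + μ ≠ 0 := by linarith
  have h2 : (m : ℝ) + 1 + μ ≠ 0 := by linarith
  push_cast
  field_simp

/-- Only the ratio `q (m + 1) / q m` for `m ≥ 1` matters, so `q` can be `(α+β+1)_m`, or `(m-1)!`
when `α + β + 1 = 0`. -/
lemma jacobi_symm_weights {α β : ℝ} (hα : -1 < α) (hβ : -1 < β) {q : ℕ → ℝ}
    (hq : ∀ m, 1 ≤ m → q (m + 1) = q m * (m + α + β + 1)) (m : ℕ) (hm : 1 ≤ m) :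
    jacobiDown α β (m + 1) * ((α + β + 2 * (m + 1 : ℕ) + 1) * q (m + 1) ^ 2 /
        (rising (α + 1) (m + 1) * rising (β + 1) (m + 1))) =
      -(jacobiUp α β m * ((α + β + 2 * m + 1) * q m ^ 2 /
        (rising (α + 1) m * rising (β + 1) m))) := by
  have h : (1 : ℝ) ≤ m := by exact_mod_cast hm
  have ha := (rising_pos (by linarith : 0 < α + 1) m).ne'
  have hb := (rising_pos (by linarith : 0 < β + 1) m).ne'
  rw [hq m hm, rising_succ, rising_succ, jacobiDown, jacobiUp, if_neg (by omega)]
  have n1 : (m : ℝ) + α + 1 ≠ 0 := by linarith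
  have n2 : (m : ℝ) + β + 1 ≠ 0 := by linarith
  have n3 : (m : ℝ) + α + β + 1 ≠ 0 := by linarith
  have n4 : 2 * (m : ℝ) + α + β + 1 ≠ 0 := by linarith
  have n5 : 2 * (m : ℝ) + α + β + 2 ≠ 0 := by linarith
  have n6 : 2 * (m : ℝ) + α + β + 3 ≠ 0 := by linarith
  push_cast
  rw [show (m : ℝ) + 1 + α = m + α + 1 by ring, show (m : ℝ) + 1 + β = m + β + 1 by ring,
    show (m : ℝ) + α + 1 + β = m + α + β + 1 by ring,
    show 2 * ((m : ℝ) + 1) + α + β = 2 * m + α + β + 2 by ring,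
    show 2 * (m : ℝ) + α + β + 2 + 1 = 2 * m + α + β + 3 by ring,
    show α + β + 2 * ((m : ℝ) + 1) + 1 = 2 * m + α + β + 3 by ring,
    show α + β + 2 * (m : ℝ) + 1 = 2 * m + α + β + 1 by ring,
    show α + 1 + (m : ℝ) = m + α + 1 by ring, show β + 1 + (m : ℝ) = m + β + 1 by ring]
  field_simp

lemma jacobi_isConvMatrix_symm {α β : ℝ} (hα : -1 < α) (hβ : -1 < β) {q : ℕ → ℝ}
    (hq : ∀ m, 1 ≤ m → q (m + 1) = q m * (m + α + β + 1)) (hq0 : ∀ m, 1 ≤ m → q m ≠ 0)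
    {M N : ℕ} {a : Fin (M + 1) → ℝ} {R : Matrix (Fin (M + N + 2)) (Fin (N + 1)) ℝ}
    (hR : IsConvMatrix (jacobiP α β) a R) {k n : ℕ}
    (hk : M + 1 ≤ k) (hn : M + 1 ≤ n) (hkc : k < N + 1) (hnc : n < N + 1)
    (hkr : k < M + N + 2) (hnr : n < M + N + 2) :
    R ⟨n, hnr⟩ ⟨k, hkc⟩ =
      (-1) ^ (k + n) *
        (((α + β + 2 * n + 1) * rising (α + 1) k * rising (β + 1) k * q n ^ 2) /
          ((α + β + 2 * k + 1) * rising (α + 1) n * rising (β + 1) n * q k ^ 2)) *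
        R ⟨k, hkr⟩ ⟨n, hnc⟩ := by
  have h := (jacobiSeq hα hβ).isConvMatrix_symm (jacobiP_eq_eval α β) a
    (D := fun m => (α + β + 2 * m + 1) * q m ^ 2 / (rising (α + 1) m * rising (β + 1) m))
    (jacobiPoly_recurrence hα hβ) (jacobi_symm_weights hα hβ hq) hR hk hn hkc hnc hkr hnr
  have hk1 : (1 : ℝ) ≤ k := by exact_mod_cast (by omega : 1 ≤ k)
  have e1 := (rising_pos (by linarith : 0 < α + 1) k).ne'
  have e2 := (rising_pos (by linarith : 0 < β + 1) k).ne'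
  have e3 := (rising_pos (by linarith : 0 < α + 1) n).ne'
  have e4 := (rising_pos (by linarith : 0 < β + 1) n).ne'
  have e5 : α + β + 2 * (k : ℝ) + 1 ≠ 0 := by linarith
  have e6 := hq0 k (by omega)
  beta_reduce at h
  rw [div_mul_eq_mul_div, div_eq_iff (mul_ne_zero e1 e2)] at h
  rw [← mul_right_inj' (mul_ne_zero e5 (pow_ne_zero 2 e6)), h]
  field_simp

theorem theorem4p7 (M N : ℕ) (a : Fin (M + 1) → ℝ) :
    -- Jacobi
    (∀ α β : ℝ, -1 < α → -1 < β →
      (∃! R : Matrix (Fin (M + N + 2)) (Fin (N + 1)) ℝ, IsConvMatrix (jacobiP α β) a R) ∧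
      ∀ R : Matrix (Fin (M + N + 2)) (Fin (N + 1)) ℝ, IsConvMatrix (jacobiP α β) a R →
        ∀ (k n : ℕ) (_ : M + 1 ≤ k) (_ : k ≤ N) (_ : M + 1 ≤ n) (_ : n ≤ N),
          (α + β + 1 ≠ 0 →
            R ⟨n, by omega⟩ ⟨k, by omega⟩ =
              (-1) ^ (k + n) *
                (((α + β + 2 * n + 1) * rising (α + 1) k * rising (β + 1) k
                    * rising (α + β + 1) n ^ 2) /
                  ((α + β + 2 * k + 1) * rising (α + 1) n * rising (β + 1) n
                    * rising (α + β + 1) k ^ 2)) *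
                R ⟨k, by omega⟩ ⟨n, by omega⟩) ∧
          -- here `(α+β+1)_n / (α+β+1)_k` has a removable singularity, with value `(n-1)! / (k-1)!`
          (α + β + 1 = 0 →
            R ⟨n, by omega⟩ ⟨k, by omega⟩ =
              (-1) ^ (k + n) *
                (((α + β + 2 * n + 1) * rising (α + 1) k * rising (β + 1) k
                    * (Nat.factorial (n - 1) : ℝ) ^ 2) /
                  ((α + β + 2 * k + 1) * rising (α + 1) n * rising (β + 1) n
                    * (Nat.factorial (k - 1) : ℝ) ^ 2)) *
                R ⟨k, by omega⟩ ⟨n, by omega⟩)) ∧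
    -- Chebyshev
    ((∃! R : Matrix (Fin (M + N + 2)) (Fin (N + 1)) ℝ, IsConvMatrix chebyshevT a R) ∧
      ∀ R : Matrix (Fin (M + N + 2)) (Fin (N + 1)) ℝ, IsConvMatrix chebyshevT a R →
        ∀ (k n : ℕ) (_ : M + 1 ≤ k) (_ : k ≤ N) (_ : M + 1 ≤ n) (_ : n ≤ N),
          R ⟨n, by omega⟩ ⟨k, by omega⟩ =
            (-1) ^ (n + k) * (k : ℝ) / n * R ⟨k, by omega⟩ ⟨n, by omega⟩) ∧
    -- Gegenbauer
    (∀ μ : ℝ, -1 / 2 < μ → μ ≠ 0 →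
      (∃! R : Matrix (Fin (M + N + 2)) (Fin (N + 1)) ℝ, IsConvMatrix (gegenbauerC μ) a R) ∧
      ∀ R : Matrix (Fin (M + N + 2)) (Fin (N + 1)) ℝ, IsConvMatrix (gegenbauerC μ) a R →
        ∀ (k n : ℕ) (_ : M + 1 ≤ k) (_ : k ≤ N) (_ : M + 1 ≤ n) (_ : n ≤ N),
          R ⟨k, by omega⟩ ⟨n, by omega⟩ =
            (-1) ^ (k + n) * ((k + μ) / (n + μ)) * R ⟨n, by omega⟩ ⟨k, by omega⟩) := by
  refine ⟨fun α β hα hβ => ⟨?_, fun R hR k n hk hkN hn hnN => ⟨fun h0 => ?_, fun h0 => ?_⟩⟩,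
    ⟨?_, fun R hR k n hk hkN hn hnN => ?_⟩,
    fun μ hμ h0 => ⟨?_, fun R hR k n hk hkN hn hnN => ?_⟩⟩
  · exact (jacobiSeq hα hβ).existsUnique_isConvMatrix (jacobiP_eq_eval α β) a
  · refine jacobi_isConvMatrix_symm hα hβ (q := rising (α + β + 1)) (fun m _ => ?_)
      (fun m hm => ?_) hR hk hn (by omega) (by omega)
      (by omega) (by omega)
    · rw [rising_succ]; ring
    -- The first factor `α + β + 1` may be negative but is nonzero; the remaining ones are positive
    -- since `α + β + 2 > 0`.
    · obtain ⟨m, rfl⟩ : ∃ l, m = l + 1 := ⟨m - 1, by omega⟩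
      rw [rising_succ_left]
      exact mul_ne_zero h0 (rising_pos (by linarith) m).ne'
  · refine jacobi_isConvMatrix_symm hα hβ (q := fun m => ((m - 1)! : ℝ)) (fun m hm => ?_)
      (fun m _ => by positivity) hR hk hn (by omega) (by omega)
      (by omega) (by omega)
    obtain ⟨m, rfl⟩ : ∃ l, m = l + 1 := ⟨m - 1, by omega⟩
    simp only [Nat.add_sub_cancel, Nat.factorial_succ]
    push_cast
    linear_combination -(m ! : ℝ) * h0
  · exact chebyshevSeq.existsUnique_isConvMatrix (fun _ _ => rfl) a
  · have h := chebyshevSeq.isConvMatrix_symm (fun _ _ => rfl) a (D := fun m => (m : ℝ)⁻¹)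
      chebyshevSeq_recurrence chebyshev_symm_weights hR hk hn (by omega) (by omega)
      (by omega) (by omega)
    have e : (k : ℝ) ≠ 0 := Nat.cast_ne_zero.2 (by omega)
    rw [inv_mul_eq_iff_eq_mul₀ e] at h
    rw [h, add_comm k n]
    ring
  · exact (gegenbauerSeq hμ h0).existsUnique_isConvMatrix (gegenbauerC_eq_eval μ) a
  -- The roles of `k` and `n` are exchanged to match the orientation of this case.
  · have h := (gegenbauerSeq hμ h0).isConvMatrix_symm (gegenbauerC_eq_eval μ) a
      (D := fun m => (m : ℝ) + μ) (gegenbauerPoly_recurrence hμ h0)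
      (gegenbauer_symm_weights hμ) hR hn hk (by omega) (by omega)
      (by omega) (by omega)
    have hn1 : (1 : ℝ) ≤ n := by exact_mod_cast (by omega : 1 ≤ n)
    have e : (n : ℝ) + μ ≠ 0 := by linarith
    rw [← mul_right_inj' e, h, add_comm n k]
    field_simp
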